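/- Let $d\in\{2,3\}$ and let $\sigma$ be a real number. There exist constants $c_0,c_1>0$, depending only on $d$ and $\sigma$, such that the following holds. Let $\Omega\subset\mathbb R^d$ be an open set with $\Omega=\operatorname{int}\overline\Omega$ (for example, a bounded Lipschitz domain). Let $\mathcal T_h$ be a finite conforming triangulation by closed simplices with $\bigcup_{K\in\mathcal T_h}K=\overline\Omega$, and put $h_K=\operatorname{diam}K$, $h=\max_{K\in\mathcal T_h}h_K$. Assume that $\mathcal T_h$ is shape regular with constant $\sigma$: every $K\in\mathcal T_h$ contains a ball of some diameter $\rho_K>0$ with $h_K\le\sigma\rho_K$. Let $\Omega_k\subset\Omega$ be nonempty (for example, one of the two parts into which an interface divides $\Omega$), let $\delta\ge 0$, and define $$\mathcal T_{h,k}=\{K\in\mathcal T_h:\ \exists\,x\in K,\ \operatorname{dist}(x,\Omega_k)\le\delta\},\qquad \Omega_{h,k}=\operatorname{int}\bigcup_{K\in\mathcal T_{h,k}}K .$$ Let $V_{h,k}$ be the space of continuous functions that are affine on every $K\in\mathcal T_{h,k}$ and vanish on $\partial\Omega\cap\partial\Omega_{h,k}$. Let $x_j$, $j=1,\dots,N$,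 be the vertices of the simplices in $\mathcal T_{h,k}$ that do not lie on $\partial\Omega\cap\partial\Omega_{h,k}$, and let $\varphi_j$ be the corresponding nodal basis functions of $V_{h,k}$ (hat functions). For $\mathbf v\in L^2(\Omega_{h,k})^d$ let $$\mathcal P_k\mathbf v=\sum_{j=1}^N \frac{\int_{\Omega_{h,k}}\varphi_j\,\mathbf v\,dx}{\int_{\Omega_{h,k}}\varphi_j\,dx}\;\varphi_j .$$ Let $K_1\neq K_2$ be simplices of $\mathcal T_{h,k}$ that share a $(d-1)$-dimensional face $f$, put $\omega(f)=K_1\cup K_2$ and $h_f=\max\{h_{K_1},h_{K_2}\}$, and define $$s^f_{h,k}(u,v)=\int_{\omega(f)}(\nabla u-\mathcal P_k\nabla u)\cdot(\nabla v-\mathcal P_k\nabla v)\,dx+h_f^2\int_{\omega(f)}(\nabla\mathcal P_k\nabla u):(\nabla\mathcal P_k\nabla v)\,dx .$$ Then $$c_1\|\nabla u\|^2_{L^2(K_2)}\le\|\nabla u\|^2_{L^2(K_1)}+s^f_{h,k}(u,u)\qquad\text{for all }u\in H^1(\Omega_{h,k}),$$ $$c_0\|u_h\|^2_{L^2(K_2)}\le\|u_h\|^2_{L^2(K_1)}+h^2\,s^f_{h,k}(u_h,u_h)\qquad\text{for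 all }u_h\in V_{h,k}.$$ -/

import Mathlib

open MeasureTheory Set

open scoped ContDiff

noncomputable section

namespace PG

/-- Euclidean space `ℝ^d`. -/
abbrev Pt (d : ℕ) : Type := EuclideanSpace ℝ (Fin d)

variable {d : ℕ}

/-! ### Sobolev space `H¹` and weak gradients -/

/-- `g` is a weak gradient of `u` on `U`. -/
def IsWeakGrad (U : Set (Pt d)) (u : Pt d → ℝ) (g : Pt d → Pt d) : Prop :=
  ∀ φ : Pt d → ℝ, ContDiff ℝ ∞ φ → HasCompactSupport φ → tsupport φ ⊆ U →
    ∫ x in U, u x • gradient φ x = -∫ x in U, φ x • g x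

/-- `u ∈ H¹(U)`: both `u` and a weak gradient of `u` are square integrable on `U`. -/
def MemH1 (U : Set (Pt d)) (u : Pt d → ℝ) : Prop :=
  MemLp u 2 (volume.restrict U) ∧
    ∃ g : Pt d → Pt d, MemLp g 2 (volume.restrict U) ∧ IsWeakGrad U u g

open Classical in
/-- The weak gradient `∇u` on `U` of `u ∈ H¹(U)` (unique up to a null set when `U` is open). -/
def weakGrad (U : Set (Pt d)) (u : Pt d → ℝ) : Pt d → Pt d :=
  if h : MemH1 U u then h.2.choose else 0

/-! ### Triangulations -/

/-- The closed simplex with vertex set `K`. -/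
def simplex (K : Finset (Pt d)) : Set (Pt d) := convexHull ℝ (K : Set (Pt d))

/-- The mesh cells: the `d`-dimensional simplices of the complex, given by their vertex sets. -/
def cells (T : Geometry.SimplicialComplex ℝ (Pt d)) : Set (Finset (Pt d)) :=
  {K | K ∈ T.faces ∧ K.card = d + 1}

/-- A (finite, conforming) triangulation of `Ω`, fitted to `Ω`. Conformity is part of
`Geometry.SimplicialComplex`: two simplices meet exactly in the simplex spanned by their common
vertices. -/
structure IsTriangulation (T : Geometry.SimplicialComplex ℝ (Pt d)) (Ω : Set (Pt d)) :
    Prop where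
  finite : T.faces.Finite
  pure : ∀ F ∈ T.faces, ∃ K ∈ cells T, F ⊆ K
  fitted : ⋃ K ∈ cells T, simplex K = closure Ω

/-- The diameter `h_K` of a cell. -/
def cellDiam (K : Finset (Pt d)) : ℝ := Metric.diam (simplex K)

/-- The mesh size `h = max_K h_K`. -/
def meshSize (T : Geometry.SimplicialComplex ℝ (Pt d)) : ℝ :=
  sSup (cellDiam '' cells T)

/-- Shape regularity with constant `σ`: every cell `K` contains a ball of diameter `ρ`
with `h_K ≤ σ ρ`. -/
def ShapeRegular (T : Geometry.SimplicialComplex ℝ (Pt d)) (σ : ℝ) : Prop :=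
  ∀ K ∈ cells T, ∃ (c : Pt d) (r : ℝ), 0 < r ∧
    Metric.closedBall c r ⊆ simplex K ∧ cellDiam K ≤ σ * (2 * r)

/-- The sub-triangulation `T_{h,k}(δ)` of the cells that meet the closed `δ`-neighbourhood of
the subdomain `Ωk`. -/
def subMesh (T : Geometry.SimplicialComplex ℝ (Pt d)) (Ωk : Set (Pt d)) (δ : ℝ) :
    Set (Finset (Pt d)) :=
  {K | K ∈ cells T ∧ ∃ x ∈ simplex K, Metric.infDist x Ωk ≤ δ}

/-- The open region `int (⋃ K)` covered by a set of cells. -/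
def region (M : Set (Finset (Pt d))) : Set (Pt d) := interior (⋃ K ∈ M, simplex K)

/-! ### Linear finite elements on a set `M` of cells of a triangulation of `Ω` -/

/-- The space `V_{h,k}` (degree one): continuous, affine on each cell, zero on the part of the
boundary of `Ω` that belongs to the boundary of the region. -/
def feSpace (Ω : Set (Pt d)) (M : Set (Finset (Pt d))) : Set (Pt d → ℝ) :=
  {v | ContinuousOn v (region M) ∧
    (∀ K ∈ M, ∃ a : Pt d →ᵃ[ℝ] ℝ, EqOn v a (simplex K)) ∧
    ∀ x ∈ frontier Ω ∩ frontier (region M), v x = 0}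

/-- The nodes of `V_{h,k}`: the vertices of the cells off the Dirichlet boundary. -/
def nodes (Ω : Set (Pt d)) (M : Set (Finset (Pt d))) : Set (Pt d) :=
  {x | (∃ K ∈ M, x ∈ K) ∧ x ∉ frontier Ω ∩ frontier (region M)}

/-- `w` is the family of barycentric coordinates of `y` in the simplex with vertex set `K`,
extended by zero to points that are not vertices of `K`. -/
def IsBary (K : Finset (Pt d)) (y : Pt d) (w : Pt d → ℝ) : Prop :=
  (∀ v ∈ K, 0 ≤ w v) ∧ (∀ v, v ∉ K → w v = 0) ∧ ∑ v ∈ K, w v = 1 ∧ ∑ v ∈ K, w v • v = y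

open Classical in
/-- The nodal (hat) function `φ_x` of the vertex `x`: at a point `y` of a cell it is the
barycentric coordinate of `y` at `x` (the coordinates do not depend on the cell containing `y`,
by conformity); it is zero outside the cells. -/
def hat (M : Set (Finset (Pt d))) (x y : Pt d) : ℝ :=
  if h : ∃ w : Pt d → ℝ, ∃ K ∈ M, IsBary K y w then h.choose x else 0

/-- The coefficient `g_x(v) = ∫ v φ_x / ∫ φ_x` of the lumped-mass projection. -/
def lumpedCoeff (M : Set (Finset (Pt d))) (v : Pt d → Pt d) (x : Pt d) : Pt d :=
  (∫ y in region M, hat M x y)⁻¹ • ∫ y in region M, hat M x y • v y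

/-- The lumped-mass `L²` projection `P_k v = ∑_x g_x(v) φ_x` into `(V_{h,k})^d`. -/
def lumpedProj (Ω : Set (Pt d)) (M : Set (Finset (Pt d))) (v : Pt d → Pt d) : Pt d → Pt d :=
  fun y => ∑ᶠ x ∈ nodes Ω M, hat M x y • lumpedCoeff M v x

/-- `∇u` on the region of `M`. -/
def grad (M : Set (Finset (Pt d))) (u : Pt d → ℝ) : Pt d → Pt d := weakGrad (region M) u

/-- `P_k ∇u`. -/
def projGrad (Ω : Set (Pt d)) (M : Set (Finset (Pt d))) (u : Pt d → ℝ) : Pt d → Pt d :=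
  lumpedProj Ω M (grad M u)

/-- The local stabilization form on the patch `ω(f) = K ∪ K'`:
`∫ (∇u - P_k∇u)·(∇v - P_k∇v) + h_f² ∫ (∇P_k∇u) : (∇P_k∇v)`, with `h_f = max h_K h_K'`. -/
def localStab (Ω : Set (Pt d)) (M : Set (Finset (Pt d))) (K K' : Finset (Pt d))
    (u v : Pt d → ℝ) : ℝ :=
  (∫ x in simplex K ∪ simplex K',
      inner ℝ (grad M u x - projGrad Ω M u x) (grad M v x - projGrad Ω M v x)) +
    max (cellDiam K) (cellDiam K') ^ 2 *
      ∫ x in simplex K ∪ simplex K',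
        ∑ i : Fin d, inner ℝ (grad M (fun y => projGrad Ω M u y i) x)
          (grad M (fun y => projGrad Ω M v y i) x)

/-- `K₁` and `K₂` are the two distinct cells of `M` sharing the facet with vertex set `f`. -/
def SharesFace (M : Set (Finset (Pt d))) (K₁ K₂ f : Finset (Pt d)) : Prop :=
  K₁ ∈ M ∧ K₂ ∈ M ∧ K₁ ≠ K₂ ∧ f.card = d ∧ f ⊆ K₁ ∧ f ⊆ K₂

end PG

end

/-!
Since `P_k ∇u` is piecewise affine, its values on two neighbouring cells can be compared through a
common vertex: up to the diameters times the gradients, the `L²` norm on one cell controls the norm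
on the other. The stabilization form bounds these gradients as well as the distance between `∇u` and
`P_k ∇u`, so the gradient of `u` is transferred from `K₁` to `K₂`. For a finite element function the
same comparison applies directly, with its gradient on `K₁` bounded by the inverse inequality and
its gradient on `K₂` by the first estimate.

The diameters of the two cells are comparable because in dimension at least two the common face
contains an edge, and an edge of a simplex is at least as long as the diameter of an inscribed ball.
-/

noncomputable section

namespace PG

open Filter Metric Module Topology
open scoped NNReal

theorem dist_le_of_finite_closed_cover {X ι : Type*} [PseudoMetricSpace X] [Finite ι] {f : ℝ → X}
    {C : ℝ≥0} {S : ι → Set ℝ} {a b : ℝ} (hab : a ≤ b) (hS : ∀ i, IsClosed (S i))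
    (hcov : Icc a b ⊆ ⋃ i, S i) (hC : ∀ i, LipschitzOnWith C f (S i)) :
    dist (f a) (f b) ≤ C * (b - a) := by
  have hf : ContinuousOn f (Icc a b) :=
    ((locallyFinite_of_finite S).continuousOn_iUnion hS fun i => (hC i).continuousOn).mono hcov
  suffices Icc a b ⊆ {t | dist (f a) (f t) ≤ C * (t - a)} from this (right_mem_Icc.2 hab)
  refine IsClosed.Icc_subset_of_forall_exists_gt ?_ (by simp) ?_
  · have hg : ContinuousOn (fun t => C * (t - a) - dist (f a) (f t)) (Icc a b) := by fun_prop
    convert! hg.preimage_isClosed_of_isClosed isClosed_Icc (t := Ici 0) isClosed_Ici using 1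
    ext t
    simp [and_comm]
  rintro x ⟨hx, hxab⟩ y hy
  have hright : Ioc x (min y b) ∈ 𝓝[>] x := Ioc_mem_nhdsGT (lt_min hy hxab.2)
  -- Finitely many pieces cover a right neighbourhood of `x`, so one of them accumulates at `x`.
  obtain ⟨i, hi⟩ : ∃ i, ∃ᶠ t in 𝓝[>] x, t ∈ S i := by
    by_contra! hnot
    simp only [← eventually_all] at hnot
    obtain ⟨t, ht, hxt⟩ := (hnot.and hright).exists
    obtain ⟨i, hti⟩ := mem_iUnion.1 (hcov ⟨hxab.1.trans hxt.1.le, hxt.2.trans (min_le_right _ _)⟩)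
    exact ht i hti
  have hxi : x ∈ S i :=
    (hS i).mem_of_frequently_of_tendsto hi (tendsto_id.mono_left nhdsWithin_le_nhds)
  obtain ⟨t, hti, hxt⟩ := (hi.and_eventually hright).exists
  refine ⟨t, ?_, hxt.1, hxt.2.trans (min_le_left _ _)⟩
  have hstep : dist (f x) (f t) ≤ C * (t - x) := by
    simpa [Real.dist_eq, abs_sub_comm x, abs_of_pos (sub_pos.2 hxt.1)] using
      (hC i).dist_le_mul x hxi t hti
  calc dist (f a) (f t) ≤ dist (f a) (f x) + dist (f x) (f t) := dist_triangle _ _ _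
    _ ≤ C * (x - a) + C * (t - x) := add_le_add hx hstep
    _ = C * (t - a) := by ring

theorem lipschitzOnWith_of_finite_closed_cover {E X ι : Type*} [NormedAddCommGroup E]
    [NormedSpace ℝ E] [PseudoMetricSpace X] [Finite ι] {f : E → X} {C : ℝ≥0} {s : Set E}
    {S : ι → Set E} (hs : Convex ℝ s) (hS : ∀ i, IsClosed (S i)) (hcov : s ⊆ ⋃ i, S i)
    (hC : ∀ i, LipschitzOnWith C f (S i)) : LipschitzOnWith C f s := by
  refine LipschitzOnWith.of_dist_le_mul fun x hx y hy => ?_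
  have hline : Continuous (AffineMap.lineMap x y : ℝ → E) := AffineMap.lineMap_continuous
  have hsegment : Icc (0 : ℝ) 1 ⊆ ⋃ i, AffineMap.lineMap x y ⁻¹' S i := fun t ht => by
    simpa using hcov (hs.lineMap_mem hx hy ht)
  simpa using dist_le_of_finite_closed_cover (f := f ∘ AffineMap.lineMap x y) zero_le_one
    (fun i => (hS i).preimage hline) hsegment fun i =>
      (hC i).comp (lipschitzWith_lineMap x y).lipschitzOnWith (mapsTo_preimage _ _)

theorem measureReal_le_of_diam_le {E : Type*} [NormedAddCommGroup E] [NormedSpace ℝ E]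
    [FiniteDimensional ℝ E] [MeasurableSpace E] [BorelSpace E] (μ : Measure E)
    [μ.IsAddHaarMeasure] {S : Set E} (hS : Bornology.IsBounded S) (c : E) {r t : ℝ} (hr : 0 ≤ r)
    (ht : 0 ≤ t) (hd : diam S ≤ t * r) :
    μ.real S ≤ t ^ finrank ℝ E * μ.real (closedBall c r) := by
  rcases S.eq_empty_or_nonempty with rfl | ⟨x, hx⟩
  · rw [measureReal_empty]
    positivity
  have hsub : S ⊆ closedBall x (t * r) := fun y hy => (dist_le_diam_of_mem hS hy hx).trans hd
  calc μ.real S ≤ μ.real (closedBall x (t * r)) :=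
        measureReal_mono hsub isBounded_closedBall.measure_lt_top.ne
    _ = t ^ finrank ℝ E * μ.real (closedBall c r) := by
        rw [Measure.addHaar_real_closedBall _ _ (by positivity),
          Measure.addHaar_real_closedBall _ _ hr, mul_pow, mul_assoc]

/-- An inscribed ball has at most unit variation in each barycentric coordinate, which varies by
exactly one along an edge. -/
theorem two_mul_radius_le_dist {ι E : Type*} [Finite ι] [NormedAddCommGroup E] [NormedSpace ℝ E]
    (b : AffineBasis ι ℝ E) {c : E} {r : ℝ} (hr : 0 ≤ r)
    (hball : closedBall c r ⊆ convexHull ℝ (range b)) {i j : ι} (hij : i ≠ j) :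
    2 * r ≤ dist (b i) (b j) := by
  have := Fintype.ofFinite ι
  have hnonneg : ∀ y ∈ closedBall c r, ∀ k, 0 ≤ b.coord k y := fun y hy => by
    simpa [b.convexHull_eq_nonneg_coord] using hball hy
  have hle_one : ∀ y ∈ closedBall c r, b.coord i y ≤ 1 := fun y hy => by
    rw [← b.sum_coord_apply_eq_one y]
    exact Finset.single_le_sum (fun k _ => hnonneg y hy k) (Finset.mem_univ i)
  have hpos : 0 < dist (b i) (b j) := dist_pos.2 (b.ind.injective.ne hij)
  set z : E := (r / dist (b i) (b j)) • (b i - b j) with hz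
  have hznorm : ‖z‖ = r := by
    rw [hz, norm_smul, Real.norm_of_nonneg (by positivity), ← dist_eq_norm,
      div_mul_cancel₀ _ hpos.ne']
  have hedge : (b.coord i).linear (b i - b j) = 1 := by
    simpa [b.coord_apply_ne hij] using (b.coord i).linearMap_vsub (b i) (b j)
  have hdiff : b.coord i (c + z) - b.coord i (c - z) = 2 * (r / dist (b i) (b j)) := by
    have hlin := (b.coord i).linearMap_vsub (c + z) (c - z)
    simp only [vsub_eq_sub, add_sub_sub_cancel, map_add] at hlin
    rw [← hlin, hz, map_smul, hedge, smul_eq_mul, mul_one, two_mul]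
  have hplus := hle_one (c + z) (by simp [hznorm])
  have hminus := hnonneg (c - z) (by simp [hznorm]) i
  have hratio : 2 * r / dist (b i) (b j) ≤ 1 := by
    rw [mul_div_assoc]
    linarith
  exact (div_le_one hpos).1 hratio

/-! ### Affine functions on subsets of an inner product space -/

section AffineOnWith

variable {E : Type*} [NormedAddCommGroup E] [InnerProductSpace ℝ E]

/-- `v` is affine on `S` with gradient `G`. The set `S` may be degenerate, so that `G` need not be
determined by `v`. -/
def AffineOnWith (G : E) (v : E → ℝ) (S : Set E) : Prop :=
  ∀ x ∈ S, ∀ y ∈ S, v y - v x = inner ℝ G (y - x)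

variable {G : E} {v : E → ℝ} {S : Set E}

theorem exists_affineOnWith_affineMap [FiniteDimensional ℝ E] (a : E →ᵃ[ℝ] ℝ) (S : Set E) :
    ∃ G, AffineOnWith G a S := by
  refine ⟨(InnerProductSpace.toDual ℝ E).symm (LinearMap.toContinuousLinearMap a.linear),
    fun x _ y _ => ?_⟩
  simpa using (a.linearMap_vsub y x).symm

namespace AffineOnWith

theorem neg (hv : AffineOnWith G v S) : AffineOnWith (-G) (-v) S := fun x hx y hy => by
  rw [inner_neg_left, ← hv x hx y hy]
  simp only [Pi.neg_apply]
  ring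

theorem lipschitzOnWith (hv : AffineOnWith G v S) : LipschitzOnWith ‖G‖₊ v S :=
  LipschitzOnWith.of_dist_le_mul fun x hx y hy => by
    rw [Real.dist_eq, hv y hy x hx, dist_eq_norm]
    exact abs_real_inner_le_norm _ _

theorem sq_sub_le (hv : AffineOnWith G v S) (hS : Bornology.IsBounded S) {x y : E} (hx : x ∈ S)
    (hy : y ∈ S) : (v y - v x) ^ 2 ≤ diam S ^ 2 * ‖G‖ ^ 2 := by
  rw [← mul_pow, mul_comm]
  refine sq_le_sq' (neg_le_of_abs_le ?_) (le_of_abs_le ?_) <;>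
  · calc |v y - v x| = dist (v y) (v x) := (Real.dist_eq _ _).symm
      _ ≤ ‖G‖ * dist y x := hv.lipschitzOnWith.dist_le_mul y hy x hx
      _ ≤ ‖G‖ * diam S := by gcongr; exact dist_le_diam_of_mem hS hy hx

theorem hasGradientAt [CompleteSpace E] (hv : AffineOnWith G v S) {x : E} (hx : x ∈ interior S) :
    HasGradientAt v G x := by
  have hS : S ∈ 𝓝 x := mem_interior_iff_mem_nhds.1 hx
  refine ((InnerProductSpace.toDual ℝ E G).hasFDerivAt.add_const
    (v x - inner ℝ G x)).congr_of_eventuallyEq ?_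
  filter_upwards [hS] with y hy
  have := hv x (mem_of_mem_nhds hS) y hy
  rw [inner_sub_right] at this
  rw [InnerProductSpace.toDual_apply_apply]
  linarith

theorem exists_lipschitzOnWith_mul (hv : AffineOnWith G v S) {φ : E → ℝ} (hφ : ContDiff ℝ 1 φ)
    (hφc : HasCompactSupport φ) : ∃ C, LipschitzOnWith C (φ * v) S := by
  rcases S.eq_empty_or_nonempty with rfl | ⟨x, hx⟩
  · exact ⟨0, lipschitzOnWith_empty _ _⟩
  have hsmooth : ContDiff ℝ 1 fun y => φ y * (inner ℝ G (y - x) + v x) :=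
    hφ.mul ((contDiff_const.inner ℝ (contDiff_id.sub contDiff_const)).add contDiff_const)
  obtain ⟨C, hC⟩ := hsmooth.lipschitzWith_of_hasCompactSupport hφc.mul_right one_ne_zero
  have heq : EqOn (fun y => φ y * (inner ℝ G (y - x) + v x)) (φ * v) S := fun y hy => by
    simp only [Pi.mul_apply, ← hv x hx y hy, sub_add_cancel]
  refine ⟨C, LipschitzOnWith.of_dist_le_mul fun y hy z hz => ?_⟩
  rw [← heq hy, ← heq hz]
  exact hC.dist_le_mul y z

/-- Moving half a radius from the centre in the direction in which `v²` grows leads to a smaller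
ball on which `|v| ≥ ‖G‖ r / 4`. -/
theorem exists_closedBall_forall_le_sq {c : E} {r : ℝ} (hv : AffineOnWith G v (closedBall c r))
    (hr : 0 ≤ r) : ∃ p, closedBall p (r / 4) ⊆ closedBall c r ∧
      ∀ y ∈ closedBall p (r / 4), (‖G‖ * r / 4) ^ 2 ≤ v y ^ 2 := by
  wlog hc : 0 ≤ v c generalizing v G
  · simpa using this hv.neg (neg_nonneg.2 (not_le.1 hc).le)
  obtain ⟨u, hu, hGu⟩ : ∃ u : E, ‖u‖ ≤ r / 2 ∧ inner ℝ G u = r / 2 * ‖G‖ := by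
    rcases eq_or_ne G 0 with rfl | hG
    · exact ⟨0, by rw [norm_zero]; positivity, by simp⟩
    have hGnorm : ‖G‖ ≠ 0 := norm_ne_zero_iff.2 hG
    refine ⟨(r / 2 / ‖G‖) • G, ?_, ?_⟩
    · rw [norm_smul, Real.norm_of_nonneg (by positivity), div_mul_cancel₀ _ hGnorm]
    · rw [inner_smul_right, real_inner_self_eq_norm_sq]
      field_simp
  have hsub : closedBall (c + u) (r / 4) ⊆ closedBall c r := by
    refine closedBall_subset_closedBall' ?_
    rw [dist_self_add_left]
    linarith
  refine ⟨c + u, hsub, fun y hy => pow_le_pow_left₀ (by positivity) ?_ 2⟩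
  have hvy : v y = v c + r / 2 * ‖G‖ + inner ℝ G (y - (c + u)) := by
    rw [← hGu, add_assoc, ← inner_add_right, ← sub_eq_iff_eq_add',
      hv c (mem_closedBall_self hr) y (hsub hy)]
    congr 1
    abel
  have hrest : |inner ℝ G (y - (c + u))| ≤ ‖G‖ * (r / 4) := by
    refine (abs_real_inner_le_norm _ _).trans ?_
    gcongr
    simpa [dist_eq_norm] using hy
  linarith [(abs_le.1 hrest).1]

variable [MeasurableSpace E] [BorelSpace E]

theorem integrableOn_sq (hv : AffineOnWith G v S) (hS : IsCompact S) (μ : Measure E)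
    [IsFiniteMeasureOnCompacts μ] : IntegrableOn (fun x => v x ^ 2) S μ :=
  (hv.lipschitzOnWith.continuousOn.pow 2).integrableOn_compact hS

/-- Compare both sides with the value of `v` at a common point of `S₁` and `S₂`. -/
theorem setIntegral_sq_le_of_inter_nonempty {S₁ S₂ : Set E} {G₁ G₂ : E}
    (hv₁ : AffineOnWith G₁ v S₁) (hv₂ : AffineOnWith G₂ v S₂) (hS₁ : IsCompact S₁)
    (hS₂ : IsCompact S₂) (hne : (S₁ ∩ S₂).Nonempty) {μ : Measure E}
    [IsFiniteMeasureOnCompacts μ] {τ : ℝ} (hpos : 0 < μ.real S₁)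
    (hτ : μ.real S₂ ≤ τ * μ.real S₁) :
    ∫ x in S₂, v x ^ 2 ∂μ ≤ 3 * τ * (∫ x in S₁, v x ^ 2 ∂μ) +
      3 * μ.real S₂ * (diam S₁ ^ 2 * ‖G₁‖ ^ 2 + diam S₂ ^ 2 * ‖G₂‖ ^ 2) := by
  obtain ⟨a, ha₁, ha₂⟩ := hne
  set B : ℝ := diam S₁ ^ 2 * ‖G₁‖ ^ 2 + diam S₂ ^ 2 * ‖G₂‖ ^ 2
  obtain ⟨x, hx, hxmean⟩ := exists_le_setAverage (ENNReal.toReal_pos_iff.1 hpos).1.ne'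
    hS₁.measure_lt_top.ne (hv₁.integrableOn_sq hS₁ μ)
  rw [setAverage_eq, smul_eq_mul] at hxmean
  have hpointwise : ∀ y ∈ S₂, v y ^ 2 ≤ 3 * v x ^ 2 + 3 * B := fun y hy => by
    have h₁ := hv₁.sq_sub_le hS₁.isBounded hx ha₁
    have h₂ := hv₂.sq_sub_le hS₂.isBounded ha₂ hy
    have hsplit : v y ^ 2 ≤ 3 * (v x ^ 2 + (v a - v x) ^ 2 + (v y - v a) ^ 2) := by
      nlinarith [sq_nonneg (v x - (v a - v x)), sq_nonneg (v x - (v y - v a)),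
        sq_nonneg ((v a - v x) - (v y - v a))]
    linarith
  have hτ₀ : 0 ≤ τ * μ.real S₁ := measureReal_nonneg.trans hτ
  have hconst : IntegrableOn (fun _ => 3 * v x ^ 2 + 3 * B) S₂ μ :=
    integrableOn_const hS₂.measure_lt_top.ne
  calc ∫ y in S₂, v y ^ 2 ∂μ ≤ ∫ _ in S₂, (3 * v x ^ 2 + 3 * B) ∂μ :=
        setIntegral_mono_on (hv₂.integrableOn_sq hS₂ μ) hconst hS₂.isClosed.measurableSet
          hpointwise
    _ = 3 * μ.real S₂ * v x ^ 2 + 3 * μ.real S₂ * B := by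
        rw [setIntegral_const, smul_eq_mul]
        ring
    _ ≤ 3 * (τ * μ.real S₁) * ((μ.real S₁)⁻¹ * ∫ y in S₁, v y ^ 2 ∂μ) + 3 * μ.real S₂ * B := by
        gcongr
    _ = 3 * τ * (∫ y in S₁, v y ^ 2 ∂μ) + 3 * μ.real S₂ * B := by
        field_simp

theorem inverse_inequality [FiniteDimensional ℝ E] (hv : AffineOnWith G v S) (hS : IsCompact S)
    (μ : Measure E) [μ.IsAddHaarMeasure] {c : E} {r t : ℝ} (hr : 0 < r) (ht : 0 ≤ t)
    (hball : closedBall c r ⊆ S) (hd : diam S ≤ t * r) :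
    diam S ^ 2 * (μ.real S * ‖G‖ ^ 2) ≤
      16 * t ^ 2 * (4 * t) ^ finrank ℝ E * ∫ x in S, v x ^ 2 ∂μ := by
  have hvball : AffineOnWith G v (closedBall c r) :=
    fun x hx y hy => hv x (hball hx) y (hball hy)
  obtain ⟨p, hp, hlow⟩ := hvball.exists_closedBall_forall_le_sq hr.le
  have hint := hv.integrableOn_sq hS μ
  have hsmall : (‖G‖ * r / 4) ^ 2 * μ.real (closedBall p (r / 4)) ≤ ∫ x in S, v x ^ 2 ∂μ :=
    (setIntegral_ge_of_const_le_real isClosed_closedBall.measurableSet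
      isBounded_closedBall.measure_lt_top.ne hlow (hint.mono_set (hp.trans hball))).trans
      (setIntegral_mono_set hint (.of_forall fun x => sq_nonneg _) (hp.trans hball).eventuallyLE)
  have hvol := measureReal_le_of_diam_le μ hS.isBounded p (r := r / 4) (t := 4 * t)
    (by positivity) (by positivity) (hd.trans_eq (by ring))
  calc diam S ^ 2 * (μ.real S * ‖G‖ ^ 2)
      ≤ (t * r) ^ 2 * ((4 * t) ^ finrank ℝ E * μ.real (closedBall p (r / 4)) * ‖G‖ ^ 2) := by
        gcongr
    _ = 16 * t ^ 2 * (4 * t) ^ finrank ℝ E *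
          ((‖G‖ * r / 4) ^ 2 * μ.real (closedBall p (r / 4))) := by ring
    _ ≤ _ := by gcongr

end AffineOnWith

end AffineOnWith

/-! ### Piecewise affine functions on a mesh -/

variable {d : ℕ} {T : Geometry.SimplicialComplex ℝ (Pt d)} {M : Set (Finset (Pt d))}
  {K : Finset (Pt d)}

/-- The vertices of a cell, as an affine basis of `ℝ^d`. -/
def cellBasis (hK : K ∈ cells T) : AffineBasis K ℝ (Pt d) where
  toFun := (↑)
  ind' := T.indep hK.1
  tot' := by
    rw [(T.indep hK.1).affineSpan_eq_top_iff_card_eq_finrank_add_one]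
    simp [hK.2]

theorem convexHull_range_cellBasis (hK : K ∈ cells T) :
    convexHull ℝ (range (cellBasis hK)) = simplex K :=
  congrArg (convexHull ℝ) Subtype.range_coe

open Classical in
/-- The barycentric coordinate of a cell at the point `x`, as an affine function on the whole
space. It is zero if `x` is not a vertex, in accordance with the convention in `IsBary`. -/
def baryCoord (hK : K ∈ cells T) (x : Pt d) : Pt d →ᵃ[ℝ] ℝ :=
  if hx : x ∈ K then (cellBasis hK).coord ⟨x, hx⟩ else 0

namespace IsBary

variable {y : Pt d} {w : Pt d → ℝ}

theorem eq_baryCoord (hw : IsBary K y w) (hK : K ∈ cells T) (x : Pt d) :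
    w x = baryCoord hK x y := by
  obtain ⟨-, hzero, hsum, hy⟩ := hw
  by_cases hx : x ∈ K
  · have hsum' : ∑ v : K, w v = 1 := by rwa [Finset.sum_coe_sort K w]
    have hy' : Finset.univ.affineCombination ℝ (cellBasis hK) (fun v : K => w v) = y := by
      rw [Finset.affineCombination_eq_linear_combination _ _ _ hsum', ← hy]
      exact Finset.sum_coe_sort K fun v => w v • v
    rw [baryCoord, dif_pos hx, ← hy',
      (cellBasis hK).coord_apply_combination_of_mem (Finset.mem_univ _) hsum']
  · simp [baryCoord, hx, hzero x hx]

theorem mem_simplex (hw : IsBary K y w) : y ∈ simplex K := by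
  obtain ⟨hpos, -, hsum, rfl⟩ := hw
  exact (convex_convexHull ℝ _).sum_mem hpos hsum fun v hv => subset_convexHull ℝ _ hv

theorem mono {L : Finset (Pt d)} (hw : IsBary K y w) (hKL : K ⊆ L) : IsBary L y w := by
  obtain ⟨hpos, hzero, hsum, hy⟩ := hw
  refine ⟨fun v _ => ?_, fun v hv => hzero v (mt (@hKL v) hv), ?_, ?_⟩
  · by_cases hv : v ∈ K
    exacts [hpos v hv, (hzero v hv).ge]
  · rw [← hsum, Finset.sum_subset hKL fun v _ => hzero v]
  · rw [← hy, Finset.sum_subset hKL fun v _ hv => by rw [hzero v hv, zero_smul]]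

end IsBary

theorem exists_isBary {y : Pt d} (hy : y ∈ simplex K) : ∃ w, IsBary K y w := by
  classical
  obtain ⟨w, hpos, hsum, hwy⟩ := Finset.mem_convexHull'.1 hy
  refine ⟨fun v => if v ∈ K then w v else 0, fun v hv => by simpa [hv] using hpos v hv,
    fun v hv => if_neg hv, ?_, ?_⟩
  · rw [← hsum]
    exact Finset.sum_congr rfl fun v hv => if_pos hv
  · rw [← hwy]
    exact Finset.sum_congr rfl fun v hv => by simp only [if_pos hv]

theorem eqOn_hat_baryCoord (hM : M ⊆ cells T) (hK : K ∈ M) (x : Pt d) :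
    EqOn (hat M x) (baryCoord (hM hK) x) (simplex K) := by
  classical
  intro y hy
  obtain ⟨w, hw⟩ := exists_isBary hy
  have hex : ∃ w : Pt d → ℝ, ∃ L ∈ M, IsBary L y w := ⟨w, K, hK, hw⟩
  obtain ⟨L, hL, hchosen⟩ := hex.choose_spec
  -- By conformity `y` lies in the common face, whose coordinates serve both cells.
  obtain ⟨w', hw'⟩ : ∃ w', IsBary (K ∩ L) y w' := exists_isBary <| by
    simpa [simplex] using
      T.inter_subset_convexHull (hM hK).1 (hM hL).1 ⟨hy, hchosen.mem_simplex⟩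
  rw [hat, dif_pos hex, hchosen.eq_baryCoord (hM hL),
    ← (hw'.mono Finset.inter_subset_right).eq_baryCoord (hM hL),
    (hw'.mono Finset.inter_subset_left).eq_baryCoord (hM hK)]

/-- `v` is affine on each cell of `M`. -/
def AffineOnCells (M : Set (Finset (Pt d))) (v : Pt d → ℝ) : Prop :=
  ∀ K ∈ M, ∃ a : Pt d →ᵃ[ℝ] ℝ, EqOn v a (simplex K)

theorem affineOnCells_hat (hM : M ⊆ cells T) (x : Pt d) : AffineOnCells M (hat M x) :=
  fun _ hK => ⟨_, eqOn_hat_baryCoord hM hK x⟩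

namespace AffineOnCells

theorem smul {v : Pt d → ℝ} (hv : AffineOnCells M v) (c : ℝ) : AffineOnCells M (c • v) :=
  fun K hK => by
    obtain ⟨a, ha⟩ := hv K hK
    exact ⟨c • a, fun y hy => by simp [ha hy]⟩

theorem sum {ι : Type*} {s : Finset ι} {v : ι → Pt d → ℝ}
    (hv : ∀ i ∈ s, AffineOnCells M (v i)) : AffineOnCells M (∑ i ∈ s, v i) := by
  refine Finset.sum_induction v (AffineOnCells M) (fun v w hv hw K hK => ?_)
    (fun K _ => ⟨0, fun y _ => rfl⟩) hv
  obtain ⟨a, ha⟩ := hv K hK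
  obtain ⟨b, hb⟩ := hw K hK
  exact ⟨a + b, fun y hy => by simp [ha hy, hb hy]⟩

theorem exists_affineOnWith {v : Pt d → ℝ} (hv : AffineOnCells M v) :
    ∃ G : Finset (Pt d) → Pt d, ∀ K ∈ M, AffineOnWith (G K) v (simplex K) := by
  have hcell : ∀ K ∈ M, ∃ G, AffineOnWith G v (simplex K) := fun K hK => by
    obtain ⟨a, ha⟩ := hv K hK
    obtain ⟨G, hG⟩ := exists_affineOnWith_affineMap a (simplex K)
    exact ⟨G, fun x hx y hy => by rw [ha hx, ha hy, hG x hx y hy]⟩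
  choose! G hG using hcell
  exact ⟨G, hG⟩

end AffineOnCells

theorem finite_nodes (hfin : M.Finite) (Ω : Set (Pt d)) : (nodes Ω M).Finite :=
  (hfin.biUnion fun L _ => L.finite_toSet).subset fun _ ⟨⟨_, hK, hx⟩, _⟩ =>
    mem_biUnion hK hx

theorem affineOnCells_lumpedProj (hM : M ⊆ cells T) (hfin : M.Finite) (Ω : Set (Pt d))
    (g : Pt d → Pt d) (i : Fin d) : AffineOnCells M fun y => lumpedProj Ω M g y i := by
  have hsum : (fun y => lumpedProj Ω M g y i) =
      ∑ x ∈ (finite_nodes hfin Ω).toFinset, lumpedCoeff M g x i • hat M x := by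
    ext y
    rw [lumpedProj, finsum_mem_eq_finite_toFinset_sum _ (finite_nodes hfin Ω)]
    simp [mul_comm]
  rw [hsum]
  exact .sum fun x _ => (affineOnCells_hat hM x).smul _

/-! ### Weak gradients of piecewise affine functions -/

theorem isCompact_simplex (K : Finset (Pt d)) : IsCompact (simplex K) :=
  K.finite_toSet.isCompact_convexHull ℝ

theorem measurableSet_simplex (K : Finset (Pt d)) : MeasurableSet (simplex K) :=
  (isCompact_simplex K).isClosed.measurableSet

theorem mem_simplex_of_mem {x : Pt d} (hx : x ∈ K) : x ∈ simplex K := subset_convexHull ℝ _ hx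

theorem isOpen_region (M : Set (Finset (Pt d))) : IsOpen (region M) := isOpen_interior

theorem exists_mem_simplex_of_mem_region {x : Pt d} (hx : x ∈ region M) :
    ∃ K ∈ M, x ∈ simplex K := by
  simpa using interior_subset hx

theorem isFiniteMeasure_region (hfin : M.Finite) :
    IsFiniteMeasure (volume.restrict (region M)) :=
  isFiniteMeasure_restrict.2 <| ((measure_mono interior_subset).trans_lt
    (hfin.isCompact_biUnion fun K _ => isCompact_simplex K).measure_lt_top).ne

theorem ae_mem_interior_simplex (hfin : M.Finite) :
    ∀ᵐ x : Pt d, ∀ K ∈ M, x ∈ simplex K → x ∈ interior (simplex K) := by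
  rw [ae_ball_iff hfin.countable]
  intro K _
  have hfrontier : volume (frontier (simplex K)) = 0 :=
    (convex_convexHull ℝ _).addHaar_frontier volume
  filter_upwards [measure_eq_zero_iff_ae_notMem.1 hfrontier] with x hx hxK
  by_contra hxi
  exact hx ⟨subset_closure hxK, hxi⟩

theorem ae_mem_region (hfin : M.Finite) (hK : K ∈ M) :
    ∀ᵐ x : Pt d, x ∈ simplex K → x ∈ region M := by
  filter_upwards [ae_mem_interior_simplex hfin] with x hx hxK
  exact interior_mono (subset_biUnion_of_mem (u := simplex) hK) (hx K hK hxK)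

theorem restrict_simplex_le (hfin : M.Finite) (hK : K ∈ M) :
    volume.restrict (simplex K) ≤ volume.restrict (region M) :=
  Measure.restrict_mono_ae (ae_mem_region hfin hK)

theorem integrable_smul_of_memLp {α E : Type*} [MeasurableSpace α] [NormedAddCommGroup E]
    [NormedSpace ℝ E] {μ : Measure α} {p q : ENNReal} [p.HolderConjugate q] {f : α → ℝ}
    {g : α → E} (hf : MemLp f p μ) (hg : MemLp g q μ) : Integrable (fun x => f x • g x) μ :=
  memLp_one_iff_integrable.1 (hg.smul hf)

theorem integral_lineDeriv_eq_zero {E : Type*} [NormedAddCommGroup E] [NormedSpace ℝ E]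
    [FiniteDimensional ℝ E] [MeasurableSpace E] [BorelSpace E] (μ : Measure E)
    [μ.IsAddHaarMeasure] {f : E → ℝ} {C : ℝ≥0} (hf : LipschitzWith C f)
    (hfc : HasCompactSupport f) (e : E) : ∫ x, lineDeriv ℝ f x e ∂μ = 0 := by
  have hparts := (LipschitzWith.const (1 : ℝ)).integral_lineDeriv_mul_eq (μ := μ) hf hfc (-e)
  have hconst : ∀ x, lineDeriv ℝ (fun _ : E => (1 : ℝ)) x (-e) = 0 := fun x => by
    simp [lineDeriv]
  simpa [hconst] using hparts.symm

theorem lineDeriv_mul_eq_inner {E : Type*} [NormedAddCommGroup E] [InnerProductSpace ℝ E]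
    [CompleteSpace E] {f g : E → ℝ} {x : E} (hf : DifferentiableAt ℝ f x)
    (hg : DifferentiableAt ℝ g x) (e : E) :
    lineDeriv ℝ (f * g) x e = inner ℝ e (g x • gradient f x + f x • gradient g x) := by
  rw [(hf.mul hg).lineDeriv_eq_fderiv, fderiv_mul hf hg]
  simp [inner_add_right, inner_smul_right, inner_gradient_right]
  ring

namespace AffineOnCells

variable {v : Pt d → ℝ}

theorem ae_differentiableAt (hv : AffineOnCells M v) (hfin : M.Finite) :
    ∀ᵐ x, x ∈ region M → DifferentiableAt ℝ v x := by
  obtain ⟨G, hG⟩ := hv.exists_affineOnWith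
  filter_upwards [ae_mem_interior_simplex hfin] with x hx hxU
  obtain ⟨K, hK, hxK⟩ := exists_mem_simplex_of_mem_region hxU
  exact ((hG K hK).hasGradientAt (hx K hK hxK)).differentiableAt

theorem memLp (hv : AffineOnCells M v) (hfin : M.Finite) :
    MemLp v 2 (volume.restrict (region M)) := by
  obtain ⟨G, hG⟩ := hv.exists_affineOnWith
  have hcompact : IsCompact (⋃ K ∈ M, simplex K) :=
    hfin.isCompact_biUnion fun K _ => isCompact_simplex K
  have hcont : ContinuousOn v (⋃ K ∈ M, simplex K) := by
    have := hfin.to_subtype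
    rw [biUnion_eq_iUnion]
    exact (locallyFinite_of_finite _).continuousOn_iUnion
      (fun K => (isCompact_simplex _).isClosed) fun K => (hG K K.2).lipschitzOnWith.continuousOn
  obtain ⟨B, hB⟩ := hcompact.exists_bound_of_continuousOn hcont
  have := isFiniteMeasure_region hfin
  refine MemLp.of_bound ((hcont.mono interior_subset).aestronglyMeasurable
    (isOpen_region M).measurableSet) B ?_
  exact ae_restrict_of_forall_mem (isOpen_region M).measurableSet
    fun x hx => hB x (interior_subset hx)

theorem memLp_gradient (hv : AffineOnCells M v) (hfin : M.Finite) :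
    MemLp (gradient v) 2 (volume.restrict (region M)) := by
  obtain ⟨G, hG⟩ := hv.exists_affineOnWith
  have hmeas : Measurable (gradient v) :=
    (InnerProductSpace.toDual ℝ (Pt d)).symm.continuous.measurable.comp (measurable_fderiv ℝ v)
  obtain ⟨B, hB⟩ := (hfin.image fun K => ‖G K‖).bddAbove
  have := isFiniteMeasure_region hfin
  refine MemLp.of_bound hmeas.aestronglyMeasurable B ?_
  rw [ae_restrict_iff' (isOpen_region M).measurableSet]
  filter_upwards [ae_mem_interior_simplex hfin] with x hx hxU
  obtain ⟨K, hK, hxK⟩ := exists_mem_simplex_of_mem_region hxU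
  rw [((hG K hK).hasGradientAt (hx K hK hxK)).gradient]
  exact hB (mem_image_of_mem _ hK)

/-- The complement of the region, where `φ` vanishes, completes the cells to a closed cover of the
whole space. -/
theorem exists_lipschitzWith_mul (hv : AffineOnCells M v) (hfin : M.Finite) {φ : Pt d → ℝ}
    (hφ : ContDiff ℝ 1 φ) (hφc : HasCompactSupport φ) (hφU : tsupport φ ⊆ region M) :
    ∃ C, LipschitzWith C (φ * v) := by
  have := hfin.to_subtype
  have := Fintype.ofFinite M
  obtain ⟨G, hG⟩ := hv.exists_affineOnWith
  choose C hC using fun K : M => (hG K K.2).exists_lipschitzOnWith_mul hφ hφc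
  refine ⟨Finset.univ.sup C, lipschitzOnWith_univ.1 <| lipschitzOnWith_of_finite_closed_cover
    (S := fun o : Option M => o.elim (region M)ᶜ fun K => simplex K) convex_univ ?_ ?_ ?_⟩
  · rintro (_ | K)
    exacts [(isOpen_region M).isClosed_compl, (isCompact_simplex _).isClosed]
  · intro x _
    by_cases hx : x ∈ region M
    · obtain ⟨K, hK, hxK⟩ := exists_mem_simplex_of_mem_region hx
      exact mem_iUnion_of_mem (some ⟨K, hK⟩) hxK
    · exact mem_iUnion_of_mem none hx
  · rintro (_ | K)
    · have hzero : ∀ x ∈ (region M)ᶜ, φ x = 0 := fun x hx =>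
        image_eq_zero_of_notMem_tsupport (notMem_subset hφU hx)
      exact LipschitzOnWith.of_dist_le_mul fun x hx y hy => by
        simpa [hzero x hx, hzero y hy] using by positivity
    · exact (hC K).weaken (Finset.le_sup (Finset.mem_univ K))

end AffineOnCells

theorem memLp_gradient_of_hasCompactSupport {φ : Pt d → ℝ} (hφ : ContDiff ℝ 1 φ)
    (hφc : HasCompactSupport φ) (μ : Measure (Pt d)) [IsFiniteMeasureOnCompacts μ] :
    MemLp (gradient φ) 2 μ :=
  Continuous.memLp_of_hasCompactSupport
    ((InnerProductSpace.toDual ℝ (Pt d)).symm.continuous.comp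
      (hφ.continuous_fderiv one_ne_zero))
    ((hφc.fderiv ℝ).comp_left (map_zero _))

namespace AffineOnCells

variable {v : Pt d → ℝ}

theorem isWeakGrad (hv : AffineOnCells M v) (hfin : M.Finite) :
    IsWeakGrad (region M) v (gradient v) := by
  intro φ hφ hφc hφU
  have hφ₁ : ContDiff ℝ 1 φ := hφ.of_le (mod_cast le_top)
  have hint₁ : IntegrableOn (fun x => v x • gradient φ x) (region M) :=
    integrable_smul_of_memLp (hv.memLp hfin) (memLp_gradient_of_hasCompactSupport hφ₁ hφc _)
  have hint₂ : IntegrableOn (fun x => φ x • gradient v x) (region M) :=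
    integrable_smul_of_memLp (hφ.continuous.memLp_of_hasCompactSupport (p := 2) hφc)
      (hv.memLp_gradient hfin)
  rw [← add_eq_zero_iff_eq_neg, ← integral_add hint₁ hint₂]
  refine ext_inner_left ℝ fun e => ?_
  obtain ⟨C, hC⟩ := hv.exists_lipschitzWith_mul hfin hφ₁ hφc hφU
  have hoff : ∀ x, x ∉ region M → lineDeriv ℝ (φ * v) x e = 0 := fun x hx => by
    have hzero : φ * v =ᶠ[𝓝 x] 0 := by
      filter_upwards [notMem_tsupport_iff_eventuallyEq.1 (notMem_subset hφU hx)] with y hy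
      simp [hy]
    rw [hzero.lineDeriv_eq]
    simp [lineDeriv]
  calc inner ℝ e (∫ x in region M, (v x • gradient φ x + φ x • gradient v x))
      = ∫ x in region M, inner ℝ e (v x • gradient φ x + φ x • gradient v x) :=
        (integral_inner (hint₁.add hint₂) e).symm
    _ = ∫ x in region M, lineDeriv ℝ (φ * v) x e := by
        refine setIntegral_congr_ae (isOpen_region M).measurableSet ?_
        filter_upwards [hv.ae_differentiableAt hfin] with x hx hxU
        exact (lineDeriv_mul_eq_inner (hφ₁.differentiable one_ne_zero x) (hx hxU) e).symm
    _ = ∫ x, lineDeriv ℝ (φ * v) x e := setIntegral_eq_integral_of_forall_compl_eq_zero hoff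
    _ = inner ℝ e 0 := by rw [integral_lineDeriv_eq_zero _ hC hφc.mul_right, inner_zero_right]

theorem memH1 (hv : AffineOnCells M v) (hfin : M.Finite) : MemH1 (region M) v :=
  ⟨hv.memLp hfin, _, hv.memLp_gradient hfin, hv.isWeakGrad hfin⟩

end AffineOnCells

theorem MemH1.memLp_weakGrad {U : Set (Pt d)} {u : Pt d → ℝ} (hu : MemH1 U u) :
    MemLp (weakGrad U u) 2 (volume.restrict U) := by
  rw [weakGrad, dif_pos hu]
  exact hu.2.choose_spec.1

theorem MemH1.isWeakGrad_weakGrad {U : Set (Pt d)} {u : Pt d → ℝ} (hu : MemH1 U u) :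
    IsWeakGrad U u (weakGrad U u) := by
  rw [weakGrad, dif_pos hu]
  exact hu.2.choose_spec.2

theorem IsWeakGrad.ae_eq {U : Set (Pt d)} (hU : IsOpen U) {u : Pt d → ℝ} {g g' : Pt d → Pt d}
    (hg : MemLp g 2 (volume.restrict U)) (hg' : MemLp g' 2 (volume.restrict U))
    (h : IsWeakGrad U u g) (h' : IsWeakGrad U u g') : ∀ᵐ x, x ∈ U → g x = g' x := by
  have hloc : LocallyIntegrableOn (g - g') U := locallyIntegrableOn_of_locallyIntegrable_restrict
    ((hg.sub hg').locallyIntegrable one_le_two)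
  suffices ∀ᵐ x, x ∈ U → (g - g') x = 0 by
    filter_upwards [this] with x hx hxU using sub_eq_zero.1 (hx hxU)
  refine hU.ae_eq_zero_of_integral_contDiff_smul_eq_zero hloc fun φ hφ hφc hφU => ?_
  have hφL : MemLp φ 2 (volume.restrict U) := hφ.continuous.memLp_of_hasCompactSupport hφc
  have hoff : ∀ x, x ∉ U → φ x • (g - g') x = 0 := fun x hx => by
    rw [image_eq_zero_of_notMem_tsupport (notMem_subset hφU hx), zero_smul]
  rw [← setIntegral_eq_integral_of_forall_compl_eq_zero hoff]
  simp only [Pi.sub_apply, smul_sub]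
  rw [integral_sub (integrable_smul_of_memLp hφL hg) (integrable_smul_of_memLp hφL hg'),
    sub_eq_zero, ← neg_inj, ← h φ hφ hφc hφU, h' φ hφ hφc hφU]

theorem AffineOnCells.exists_integral_grad_eq {v : Pt d → ℝ} (hv : AffineOnCells M v)
    (hfin : M.Finite) (hK : K ∈ M) :
    ∃ G, AffineOnWith G v (simplex K) ∧
      ∫ x in simplex K, ‖grad M v x‖ ^ 2 = volume.real (simplex K) * ‖G‖ ^ 2 := by
  obtain ⟨G, hG⟩ := hv.exists_affineOnWith
  refine ⟨G K, hG K hK, ?_⟩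
  have hH := hv.memH1 hfin
  have hgrad : ∀ᵐ x, x ∈ simplex K → ‖grad M v x‖ ^ 2 = ‖G K‖ ^ 2 := by
    filter_upwards [ae_mem_interior_simplex hfin, ae_mem_region hfin hK,
      hH.isWeakGrad_weakGrad.ae_eq (isOpen_region M) hH.memLp_weakGrad (hv.memLp_gradient hfin)
        (hv.isWeakGrad hfin)] with x hint hreg hclassical hx
    rw [grad, hclassical (hreg hx), ((hG K hK).hasGradientAt (hint K hK hx)).gradient]
  rw [setIntegral_congr_ae (measurableSet_simplex K) hgrad, setIntegral_const, smul_eq_mul]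

/-! ### Transfer between neighbouring cells -/

/-- The shape regularity of a single cell, with constant `σ`. -/
def ShapeRegularCell (σ : ℝ) (K : Finset (Pt d)) : Prop :=
  ∃ (c : Pt d) (r : ℝ), 0 < r ∧ closedBall c r ⊆ simplex K ∧ cellDiam K ≤ σ * (2 * r)

theorem ShapeRegularCell.mono {σ σ' : ℝ} (hK : ShapeRegularCell σ K) (hσ : σ ≤ σ') :
    ShapeRegularCell σ' K := by
  obtain ⟨c, r, hr, hball, hdiam⟩ := hK
  exact ⟨c, r, hr, hball, hdiam.trans (by gcongr)⟩

/-- `K₂` touches the shape regular cell `K₁` and is not much larger. These are the pairs of cells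
for which the norm of an affine function on `K₁` controls its norm on `K₂`. -/
structure ComparableCells (s : ℝ) (K₁ K₂ : Finset (Pt d)) : Prop where
  one_le : 1 ≤ s
  meet : (simplex K₁ ∩ simplex K₂).Nonempty
  shapeRegular : ShapeRegularCell s K₁
  diam_le : cellDiam K₂ ≤ s * cellDiam K₁

theorem SharesFace.comparableCells {K₁ K₂ f : Finset (Pt d)} {σ : ℝ} (hf : SharesFace M K₁ K₂ f)
    (hM : M ⊆ cells T) (hd : 2 ≤ d) (h₁ : ShapeRegularCell σ K₁) (h₂ : ShapeRegularCell σ K₂) :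
    ComparableCells (max σ 1) K₁ K₂ := by
  obtain ⟨-, hK₂, -, hcard, hf₁, hf₂⟩ := hf
  obtain ⟨x, hx, y, hy, hxy⟩ := Finset.one_lt_card.1 (show 1 < f.card by omega)
  refine ⟨le_max_right _ _, ⟨x, mem_simplex_of_mem (hf₁ hx), mem_simplex_of_mem (hf₂ hx)⟩,
    h₁.mono (le_max_left _ _), ?_⟩
  obtain ⟨c, r, hr, hball, hdiam⟩ := h₂.mono (le_max_left σ 1)
  have hedge : 2 * r ≤ dist x y := two_mul_radius_le_dist (cellBasis (hM hK₂)) hr.le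
    (hball.trans_eq (convexHull_range_cellBasis _).symm) (i := ⟨x, hf₂ hx⟩) (j := ⟨y, hf₂ hy⟩)
    (by simpa using hxy)
  refine hdiam.trans ?_
  gcongr
  exact hedge.trans (dist_le_diam_of_mem (isCompact_simplex K₁).isBounded
    (mem_simplex_of_mem (hf₁ hx)) (mem_simplex_of_mem (hf₁ hy)))

/-- The bound for the volume ratio of comparable cells. -/
def volRatio (d : ℕ) (s : ℝ) : ℝ := (2 * s ^ 2) ^ d

/-- The constant of the inverse inequality on a shape regular cell. -/
def inverseConst (d : ℕ) (s : ℝ) : ℝ := 16 * (2 * s) ^ 2 * (4 * (2 * s)) ^ d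

theorem one_le_volRatio (d : ℕ) {s : ℝ} (hs : 1 ≤ s) : 1 ≤ volRatio d s :=
  one_le_pow₀ (by nlinarith)

theorem inverseConst_nonneg (d : ℕ) {s : ℝ} (hs : 0 ≤ s) : 0 ≤ inverseConst d s := by
  unfold inverseConst
  positivity

theorem ShapeRegularCell.volume_pos {s : ℝ} (hK : ShapeRegularCell s K) :
    0 < volume.real (simplex K) := by
  obtain ⟨c, r, hr, hball, -⟩ := hK
  exact ENNReal.toReal_pos ((measure_closedBall_pos volume c hr).trans_le (measure_mono hball)).ne'
    (isCompact_simplex K).measure_lt_top.ne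

theorem ComparableCells.volume_le {s : ℝ} {K₁ K₂ : Finset (Pt d)} (h : ComparableCells s K₁ K₂) :
    volume.real (simplex K₂) ≤ volRatio d s * volume.real (simplex K₁) := by
  obtain ⟨c, r, hr, hball, hdiam⟩ := h.shapeRegular
  have hs := zero_le_one.trans h.one_le
  have hdiam₂ : diam (simplex K₂) ≤ 2 * s ^ 2 * r := calc
    diam (simplex K₂) ≤ s * cellDiam K₁ := h.diam_le
    _ ≤ s * (s * (2 * r)) := by gcongr
    _ = 2 * s ^ 2 * r := by ring
  have hvol := measureReal_le_of_diam_le volume (isCompact_simplex K₂).isBounded c hr.le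
    (by positivity) hdiam₂
  rw [finrank_euclideanSpace_fin] at hvol
  refine hvol.trans (mul_le_mul_of_nonneg_left ?_ (by positivity))
  exact measureReal_mono hball (isCompact_simplex K₁).measure_lt_top.ne

theorem AffineOnCells.integral_sq_le {v : Pt d → ℝ} {s : ℝ} {K₁ K₂ : Finset (Pt d)}
    (hv : AffineOnCells M v) (hfin : M.Finite) (h : ComparableCells s K₁ K₂) (hK₁ : K₁ ∈ M)
    (hK₂ : K₂ ∈ M) :
    ∫ x in simplex K₂, v x ^ 2 ≤ 3 * volRatio d s * (∫ x in simplex K₁, v x ^ 2) +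
      (3 * volRatio d s * (cellDiam K₁ ^ 2 * ∫ x in simplex K₁, ‖grad M v x‖ ^ 2) +
        3 * (cellDiam K₂ ^ 2 * ∫ x in simplex K₂, ‖grad M v x‖ ^ 2)) := by
  obtain ⟨G₁, hG₁, hint₁⟩ := hv.exists_integral_grad_eq hfin hK₁
  obtain ⟨G₂, hG₂, hint₂⟩ := hv.exists_integral_grad_eq hfin hK₂
  have hvol := h.volume_le
  refine (hG₁.setIntegral_sq_le_of_inter_nonempty hG₂ (isCompact_simplex K₁)
    (isCompact_simplex K₂) h.meet h.shapeRegular.volume_pos hvol).trans ?_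
  gcongr
  calc 3 * volume.real (simplex K₂) * (cellDiam K₁ ^ 2 * ‖G₁‖ ^ 2 + cellDiam K₂ ^ 2 * ‖G₂‖ ^ 2)
      = 3 * volume.real (simplex K₂) * (cellDiam K₁ ^ 2 * ‖G₁‖ ^ 2) +
          3 * (cellDiam K₂ ^ 2 * (volume.real (simplex K₂) * ‖G₂‖ ^ 2)) := by ring
    _ ≤ 3 * (volRatio d s * volume.real (simplex K₁)) * (cellDiam K₁ ^ 2 * ‖G₁‖ ^ 2) +
          3 * (cellDiam K₂ ^ 2 * (volume.real (simplex K₂) * ‖G₂‖ ^ 2)) := by gcongr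
    _ = _ := by
      rw [hint₁, hint₂]
      ring

theorem AffineOnCells.inverse_inequality {v : Pt d → ℝ} {s : ℝ} (hv : AffineOnCells M v)
    (hfin : M.Finite) (hK : K ∈ M) (hs : 0 ≤ s) (hreg : ShapeRegularCell s K) :
    cellDiam K ^ 2 * ∫ x in simplex K, ‖grad M v x‖ ^ 2 ≤
      inverseConst d s * ∫ x in simplex K, v x ^ 2 := by
  obtain ⟨G, hG, hint⟩ := hv.exists_integral_grad_eq hfin hK
  obtain ⟨c, r, hr, hball, hdiam⟩ := hreg
  have hinv := hG.inverse_inequality (isCompact_simplex K) volume hr (t := 2 * s) (by positivity)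
    hball (hdiam.trans_eq (by ring))
  rwa [finrank_euclideanSpace_fin, ← hint] at hinv

theorem integrableOn_norm_sq {E : Type*} [NormedAddCommGroup E] {g : Pt d → E}
    (hg : MemLp g 2 (volume.restrict (region M))) (hfin : M.Finite) (hK : K ∈ M) :
    IntegrableOn (fun x => ‖g x‖ ^ 2) (simplex K) := by
  have hgK := hg.mono_measure (restrict_simplex_le hfin hK)
  exact (memLp_two_iff_integrable_sq_norm hgK.1).1 hgK

theorem setIntegral_norm_sq_le_add {E : Type*} [NormedAddCommGroup E] {f g : Pt d → E}
    (hf : MemLp f 2 (volume.restrict (region M))) (hg : MemLp g 2 (volume.restrict (region M)))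
    (hfin : M.Finite) (hK : K ∈ M) :
    ∫ x in simplex K, ‖f x‖ ^ 2 ≤
      2 * (∫ x in simplex K, ‖g x‖ ^ 2) + 2 * ∫ x in simplex K, ‖f x - g x‖ ^ 2 := by
  have hint₁ := (integrableOn_norm_sq hg hfin hK).const_mul 2
  have hint₂ : IntegrableOn (fun x => 2 * ‖f x - g x‖ ^ 2) (simplex K) :=
    (integrableOn_norm_sq (hf.sub hg) hfin hK).const_mul 2
  rw [← integral_const_mul, ← integral_const_mul, ← integral_add hint₁ hint₂]
  refine integral_mono (integrableOn_norm_sq hf hfin hK) (hint₁.add hint₂) fun x => ?_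
  calc ‖f x‖ ^ 2 ≤ (‖g x‖ + ‖f x - g x‖) ^ 2 := by
        gcongr
        simpa using norm_add_le (g x) (f x - g x)
    _ ≤ 2 * (‖g x‖ ^ 2 + ‖f x - g x‖ ^ 2) := add_sq_le
    _ = 2 * ‖g x‖ ^ 2 + 2 * ‖f x - g x‖ ^ 2 := mul_add _ _ _

/-- The squared Frobenius norm `∇p : ∇p` of the gradient of the vector field `p`. -/
def gradNormSq (M : Set (Finset (Pt d))) (p : Pt d → Pt d) (x : Pt d) : ℝ :=
  ∑ i, ‖grad M (fun y => p y i) x‖ ^ 2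

theorem gradNormSq_nonneg (M : Set (Finset (Pt d))) (p : Pt d → Pt d) :
    0 ≤ gradNormSq M p :=
  fun _ => Finset.sum_nonneg fun _ _ => sq_nonneg _

theorem integrableOn_norm_grad_sq {v : Pt d → ℝ} (hv : AffineOnCells M v) (hfin : M.Finite)
    (hK : K ∈ M) : IntegrableOn (fun x => ‖grad M v x‖ ^ 2) (simplex K) :=
  integrableOn_norm_sq (hv.memH1 hfin).memLp_weakGrad hfin hK

theorem integrableOn_gradNormSq {p : Pt d → Pt d} (hp : ∀ i, AffineOnCells M fun y => p y i)
    (hfin : M.Finite) (hK : K ∈ M) : IntegrableOn (gradNormSq M p) (simplex K) :=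
  integrable_finsetSum _ fun i _ => integrableOn_norm_grad_sq (hp i) hfin hK

theorem integral_norm_sq_le {p : Pt d → Pt d} {s : ℝ} {K₁ K₂ : Finset (Pt d)}
    (hp : ∀ i, AffineOnCells M fun y => p y i) (hfin : M.Finite) (h : ComparableCells s K₁ K₂)
    (hK₁ : K₁ ∈ M) (hK₂ : K₂ ∈ M) :
    ∫ x in simplex K₂, ‖p x‖ ^ 2 ≤ 3 * volRatio d s * (∫ x in simplex K₁, ‖p x‖ ^ 2) +
      (3 * volRatio d s * (cellDiam K₁ ^ 2 * ∫ x in simplex K₁, gradNormSq M p x) +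
        3 * (cellDiam K₂ ^ 2 * ∫ x in simplex K₂, gradNormSq M p x)) := by
  have hnorm : ∀ K ∈ M, ∫ x in simplex K, ‖p x‖ ^ 2 = ∑ i, ∫ x in simplex K, p x i ^ 2 := by
    intro K hK
    simp only [EuclideanSpace.real_norm_sq_eq (p _)]
    refine integral_finsetSum _ fun i _ => ?_
    simpa [IntegrableOn] using integrableOn_norm_sq ((hp i).memLp hfin) hfin hK
  have hgrad : ∀ K ∈ M, ∫ x in simplex K, gradNormSq M p x =
      ∑ i, ∫ x in simplex K, ‖grad M (fun y => p y i) x‖ ^ 2 := fun K hK =>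
    integral_finsetSum _ fun i _ => integrableOn_norm_grad_sq (hp i) hfin hK
  rw [hnorm K₁ hK₁, hnorm K₂ hK₂, hgrad K₁ hK₁, hgrad K₂ hK₂]
  refine (Finset.sum_le_sum fun i _ => (hp i).integral_sq_le hfin h hK₁ hK₂).trans_eq ?_
  simp only [Finset.sum_add_distrib, Finset.mul_sum]

theorem localStab_self (Ω : Set (Pt d)) (M : Set (Finset (Pt d))) (K₁ K₂ : Finset (Pt d))
    (u : Pt d → ℝ) : localStab Ω M K₁ K₂ u u =
      (∫ x in simplex K₁ ∪ simplex K₂, ‖grad M u x - projGrad Ω M u x‖ ^ 2) +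
        max (cellDiam K₁) (cellDiam K₂) ^ 2 *
          ∫ x in simplex K₁ ∪ simplex K₂, gradNormSq M (projGrad Ω M u) x := by
  simp only [localStab, gradNormSq, real_inner_self_eq_norm_sq]

theorem localStab_self_nonneg (Ω : Set (Pt d)) (M : Set (Finset (Pt d))) (K₁ K₂ : Finset (Pt d))
    (u : Pt d → ℝ) : 0 ≤ localStab Ω M K₁ K₂ u u := by
  rw [localStab_self]
  have := integral_nonneg (μ := volume.restrict (simplex K₁ ∪ simplex K₂))
    (gradNormSq_nonneg M (projGrad Ω M u))
  positivity

theorem localStab_comm (Ω : Set (Pt d)) (M : Set (Finset (Pt d))) (K₁ K₂ : Finset (Pt d)) :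
    localStab Ω M K₁ K₂ = localStab Ω M K₂ K₁ := by
  ext u v
  rw [localStab, localStab, union_comm, max_comm]

section Stabilization

variable {Ω : Set (Pt d)} {u v : Pt d → ℝ} {s : ℝ} {K₁ K₂ : Finset (Pt d)}

theorem affineOnCells_projGrad (hM : M ⊆ cells T) (hfin : M.Finite) (i : Fin d) :
    AffineOnCells M fun y => projGrad Ω M u y i :=
  affineOnCells_lumpedProj hM hfin Ω (grad M u) i

theorem memLp_projGrad (hM : M ⊆ cells T) (hfin : M.Finite) :
    MemLp (projGrad Ω M u) 2 (volume.restrict (region M)) :=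
  MemLp.of_eval_piLp fun i => (affineOnCells_projGrad hM hfin i).memLp hfin

theorem MemH1.le_localStab (hu : MemH1 (region M) u) (hM : M ⊆ cells T) (hfin : M.Finite)
    (hK₁ : K₁ ∈ M) (hK₂ : K₂ ∈ M) :
    (∫ x in simplex K₁, ‖grad M u x - projGrad Ω M u x‖ ^ 2) +
      cellDiam K₁ ^ 2 * ∫ x in simplex K₁, gradNormSq M (projGrad Ω M u) x ≤
        localStab Ω M K₁ K₂ u u := by
  have hdefect : ∀ K ∈ M,
      IntegrableOn (fun x => ‖grad M u x - projGrad Ω M u x‖ ^ 2) (simplex K) := fun K hK =>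
    integrableOn_norm_sq (hu.memLp_weakGrad.sub (memLp_projGrad hM hfin)) hfin hK
  have hgrad : ∀ K ∈ M, IntegrableOn (gradNormSq M (projGrad Ω M u)) (simplex K) := fun K hK =>
    integrableOn_gradNormSq (affineOnCells_projGrad hM hfin) hfin hK
  have hsub : simplex K₁ ⊆ simplex K₁ ∪ simplex K₂ := subset_union_left
  have hdiam : 0 ≤ cellDiam K₁ := diam_nonneg
  rw [localStab_self]
  gcongr ?_ + ?_ ^ 2 * ?_
  · exact setIntegral_mono_set ((hdefect K₁ hK₁).union (hdefect K₂ hK₂))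
      (.of_forall fun x => sq_nonneg _) hsub.eventuallyLE
  · exact integral_nonneg (gradNormSq_nonneg _ _)
  · exact le_max_left _ _
  · exact setIntegral_mono_set ((hgrad K₁ hK₁).union (hgrad K₂ hK₂))
      (.of_forall (gradNormSq_nonneg _ _)) hsub.eventuallyLE

theorem MemH1.integral_norm_grad_sq_le (hu : MemH1 (region M) u) (hM : M ⊆ cells T)
    (hfin : M.Finite) (h : ComparableCells s K₁ K₂) (hK₁ : K₁ ∈ M) (hK₂ : K₂ ∈ M) :
    ∫ x in simplex K₂, ‖grad M u x‖ ^ 2 ≤ 18 * volRatio d s *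
      ((∫ x in simplex K₁, ‖grad M u x‖ ^ 2) + localStab Ω M K₁ K₂ u u) := by
  have hg : MemLp (grad M u) 2 (volume.restrict (region M)) := hu.memLp_weakGrad
  have hp : MemLp (projGrad Ω M u) 2 (volume.restrict (region M)) := memLp_projGrad hM hfin
  have hproj₁ := setIntegral_norm_sq_le_add hp hg hfin hK₁
  simp only [norm_sub_rev (projGrad Ω M u _)] at hproj₁
  have htransfer := integral_norm_sq_le (affineOnCells_projGrad (Ω := Ω) (u := u) hM hfin) hfin h
    hK₁ hK₂
  have hgrad₂ := setIntegral_norm_sq_le_add hg hp hfin hK₂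
  have hstab₁ := hu.le_localStab (Ω := Ω) hM hfin hK₁ hK₂
  have hstab₂ := hu.le_localStab (Ω := Ω) hM hfin hK₂ hK₁
  rw [localStab_comm] at hstab₂
  set A₁ := ∫ x in simplex K₁, ‖grad M u x‖ ^ 2
  set D₁ := ∫ x in simplex K₁, ‖grad M u x - projGrad Ω M u x‖ ^ 2
  set D₂ := ∫ x in simplex K₂, ‖grad M u x - projGrad Ω M u x‖ ^ 2
  set B₁ := cellDiam K₁ ^ 2 * ∫ x in simplex K₁, gradNormSq M (projGrad Ω M u) x
  set B₂ := cellDiam K₂ ^ 2 * ∫ x in simplex K₂, gradNormSq M (projGrad Ω M u) x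
  set S := localStab Ω M K₁ K₂ u u
  set τ := volRatio d s
  have hτ : 1 ≤ τ := one_le_volRatio d h.one_le
  have hA₁ : 0 ≤ A₁ := by positivity
  have hD₂ : 0 ≤ D₂ := by positivity
  have hB₁ : 0 ≤ B₁ := mul_nonneg (sq_nonneg _) (integral_nonneg (gradNormSq_nonneg _ _))
  have hS : 0 ≤ S := localStab_self_nonneg Ω M K₁ K₂ u
  calc ∫ x in simplex K₂, ‖grad M u x‖ ^ 2
      ≤ 2 * (3 * τ * (2 * A₁ + 2 * D₁) + (3 * τ * B₁ + 3 * B₂)) + 2 * D₂ := by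
        refine hgrad₂.trans ?_
        gcongr
        exact htransfer.trans (by gcongr)
    _ = 12 * τ * A₁ + 6 * τ * (2 * D₁ + B₁) + 2 * (D₂ + 3 * B₂) := by ring
    _ ≤ 12 * τ * A₁ + 6 * τ * (2 * S) + 2 * (3 * S) := by
        gcongr <;> linarith
    _ = 12 * τ * (A₁ + S) + 6 * S := by ring
    _ ≤ 12 * τ * (A₁ + S) + 6 * (τ * (A₁ + S)) := by
        gcongr
        nlinarith
    _ = 18 * τ * (A₁ + S) := by ring

/-- The constant in the transfer of the `L²` norm between comparable cells. -/
def transferConst (d : ℕ) (s : ℝ) : ℝ :=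
  volRatio d s * (54 + (3 + 54 * s ^ 2) * inverseConst d s)

theorem transferConst_pos (d : ℕ) {s : ℝ} (hs : 1 ≤ s) : 0 < transferConst d s := by
  have hτ := zero_lt_one.trans_le (one_le_volRatio d hs)
  have hκ := inverseConst_nonneg d (zero_le_one.trans hs)
  unfold transferConst
  positivity

theorem AffineOnCells.diam_sq_mul_integral_norm_grad_sq_le (hv : AffineOnCells M v)
    (hM : M ⊆ cells T) (hfin : M.Finite) (h : ComparableCells s K₁ K₂) (hK₁ : K₁ ∈ M)
    (hK₂ : K₂ ∈ M) {ℓ : ℝ} (hℓ : cellDiam K₂ ≤ ℓ) :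
    cellDiam K₂ ^ 2 * ∫ x in simplex K₂, ‖grad M v x‖ ^ 2 ≤ 18 * volRatio d s *
      (s ^ 2 * (inverseConst d s * ∫ x in simplex K₁, v x ^ 2) +
        ℓ ^ 2 * localStab Ω M K₁ K₂ v v) := by
  have hgrad := (hv.memH1 hfin).integral_norm_grad_sq_le (Ω := Ω) hM hfin h hK₁ hK₂
  have hinverse := hv.inverse_inequality hfin hK₁ (zero_le_one.trans h.one_le) h.shapeRegular
  have hτ : 0 ≤ volRatio d s := zero_le_one.trans (one_le_volRatio d h.one_le)
  have hS : 0 ≤ localStab Ω M K₁ K₂ v v := localStab_self_nonneg Ω M K₁ K₂ v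
  have hdiam₂ : 0 ≤ cellDiam K₂ := diam_nonneg
  set A₁ := ∫ x in simplex K₁, ‖grad M v x‖ ^ 2
  set S := localStab Ω M K₁ K₂ v v
  set τ := volRatio d s
  calc cellDiam K₂ ^ 2 * ∫ x in simplex K₂, ‖grad M v x‖ ^ 2
      ≤ cellDiam K₂ ^ 2 * (18 * τ * (A₁ + S)) := by gcongr
    _ = 18 * τ * (cellDiam K₂ ^ 2 * A₁ + cellDiam K₂ ^ 2 * S) := by ring
    _ ≤ 18 * τ * ((s * cellDiam K₁) ^ 2 * A₁ + ℓ ^ 2 * S) := by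
        gcongr
        exact h.diam_le
    _ = 18 * τ * (s ^ 2 * (cellDiam K₁ ^ 2 * A₁) + ℓ ^ 2 * S) := by ring
    _ ≤ _ := by gcongr

theorem AffineOnCells.integral_sq_le_localStab (hv : AffineOnCells M v) (hM : M ⊆ cells T)
    (hfin : M.Finite) (h : ComparableCells s K₁ K₂) (hK₁ : K₁ ∈ M) (hK₂ : K₂ ∈ M) {ℓ : ℝ}
    (hℓ : cellDiam K₂ ≤ ℓ) :
    ∫ x in simplex K₂, v x ^ 2 ≤ transferConst d s *
      ((∫ x in simplex K₁, v x ^ 2) + ℓ ^ 2 * localStab Ω M K₁ K₂ v v) := by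
  have htransfer := hv.integral_sq_le hfin h hK₁ hK₂
  have hinverse := hv.inverse_inequality hfin hK₁ (zero_le_one.trans h.one_le) h.shapeRegular
  have hscaled := hv.diam_sq_mul_integral_norm_grad_sq_le (Ω := Ω) hM hfin h hK₁ hK₂ hℓ
  have hτ : 0 ≤ volRatio d s := zero_le_one.trans (one_le_volRatio d h.one_le)
  have hκ : 0 ≤ inverseConst d s := inverseConst_nonneg d (zero_le_one.trans h.one_le)
  have hS : 0 ≤ localStab Ω M K₁ K₂ v v := localStab_self_nonneg Ω M K₁ K₂ v
  unfold transferConst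
  set V₁ := ∫ x in simplex K₁, v x ^ 2
  set S := localStab Ω M K₁ K₂ v v
  set τ := volRatio d s
  set κ := inverseConst d s
  calc ∫ x in simplex K₂, v x ^ 2
      ≤ 3 * τ * V₁ + (3 * τ * (κ * V₁) + 3 * (18 * τ * (s ^ 2 * (κ * V₁) + ℓ ^ 2 * S))) :=
        htransfer.trans (by gcongr)
    _ = τ * ((3 + (3 + 54 * s ^ 2) * κ) * V₁ + 54 * (ℓ ^ 2 * S)) := by ring
    _ ≤ τ * ((54 + (3 + 54 * s ^ 2) * κ) * V₁ + (54 + (3 + 54 * s ^ 2) * κ) * (ℓ ^ 2 * S)) := by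
        gcongr
        · norm_num
        · exact le_add_of_nonneg_right (by positivity)
    _ = τ * (54 + (3 + 54 * s ^ 2) * κ) * (V₁ + ℓ ^ 2 * S) := by ring

end Stabilization

theorem cellDiam_le_meshSize (hT : (cells T).Finite) (hK : K ∈ cells T) :
    cellDiam K ≤ meshSize T :=
  le_csSup (hT.image cellDiam).bddAbove (mem_image_of_mem cellDiam hK)

end PG

end

open PG in
theorem lemma4p2_general (d : ℕ) (hd : 2 ≤ d) (σ : ℝ) :
    ∃ c₀ c₁ : ℝ, 0 < c₀ ∧ 0 < c₁ ∧
      ∀ (Ω : Set (Pt d)) (T : Geometry.SimplicialComplex ℝ (Pt d)) (M : Set (Finset (Pt d))),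
        M ⊆ cells T → M.Finite → ∀ K₁ K₂ f : Finset (Pt d), SharesFace M K₁ K₂ f →
          ShapeRegularCell σ K₁ → ShapeRegularCell σ K₂ →
          (∀ u : Pt d → ℝ, MemH1 (region M) u →
            c₁ * ∫ x in simplex K₂, ‖grad M u x‖ ^ 2 ≤
              (∫ x in simplex K₁, ‖grad M u x‖ ^ 2) + localStab Ω M K₁ K₂ u u) ∧
          (∀ v : Pt d → ℝ, AffineOnCells M v → ∀ h : ℝ, cellDiam K₂ ≤ h →
            c₀ * ∫ x in simplex K₂, v x ^ 2 ≤
              (∫ x in simplex K₁, v x ^ 2) + h ^ 2 * localStab Ω M K₁ K₂ v v) := by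
  have hs : 1 ≤ max σ 1 := le_max_right _ _
  have hC₀ := transferConst_pos d hs
  have hC₁ : 0 < 18 * volRatio d (max σ 1) := by linarith [one_le_volRatio d hs]
  refine ⟨_, _, inv_pos.2 hC₀, inv_pos.2 hC₁, ?_⟩
  intro Ω T M hM hfin K₁ K₂ f hf h₁ h₂
  have hcomparable := hf.comparableCells hM hd h₁ h₂
  refine ⟨fun u hu => ?_, fun v hv h hh => ?_⟩
  · exact (inv_mul_le_iff₀ hC₁).2 <|
      hu.integral_norm_grad_sq_le hM hfin hcomparable hf.1 hf.2.1
  · exact (inv_mul_le_iff₀ hC₀).2 <|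
      hv.integral_sq_le_localStab hM hfin hcomparable hf.1 hf.2.1 hh

theorem lemma4p2 (d : ℕ) (hd : d = 2 ∨ d = 3) (σ : ℝ) :
    ∃ c₀ c₁ : ℝ, 0 < c₀ ∧ 0 < c₁ ∧
      ∀ (Ω Ωk : Set (PG.Pt d)) (T : Geometry.SimplicialComplex ℝ (PG.Pt d)) (δ : ℝ),
        IsOpen Ω → interior (closure Ω) = Ω → Ωk ⊆ Ω → Ωk.Nonempty → 0 ≤ δ →
        PG.IsTriangulation T Ω → PG.ShapeRegular T σ →
        ∀ K₁ K₂ f : Finset (PG.Pt d), PG.SharesFace (PG.subMesh T Ωk δ) K₁ K₂ f →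
          (∀ u : PG.Pt d → ℝ, PG.MemH1 (PG.region (PG.subMesh T Ωk δ)) u →
            c₁ * ∫ x in PG.simplex K₂, ‖PG.grad (PG.subMesh T Ωk δ) u x‖ ^ 2 ≤
              (∫ x in PG.simplex K₁, ‖PG.grad (PG.subMesh T Ωk δ) u x‖ ^ 2) +
                PG.localStab Ω (PG.subMesh T Ωk δ) K₁ K₂ u u) ∧
          (∀ v ∈ PG.feSpace Ω (PG.subMesh T Ωk δ),
            c₀ * ∫ x in PG.simplex K₂, v x ^ 2 ≤
              (∫ x in PG.simplex K₁, v x ^ 2) +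
                PG.meshSize T ^ 2 * PG.localStab Ω (PG.subMesh T Ωk δ) K₁ K₂ v v) := by
  obtain ⟨c₀, c₁, hc₀, hc₁, hmain⟩ := lemma4p2_general d (by omega) σ
  refine ⟨c₀, c₁, hc₀, hc₁, fun Ω Ωk T δ _ _ _ _ _ hT hσ K₁ K₂ f hf => ?_⟩
  have hfin : (PG.cells T).Finite := hT.finite.subset fun K hK => hK.1
  obtain ⟨hgrad, hvalue⟩ := hmain Ω T (PG.subMesh T Ωk δ) (fun K hK => hK.1)
    (hfin.subset fun K hK => hK.1) K₁ K₂ f hf (hσ K₁ hf.1.1) (hσ K₂ hf.2.1.1)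
  exact ⟨hgrad, fun v hv => hvalue v hv.2.1 _ (PG.cellDiam_le_meshSize hfin hf.2.1.1)⟩
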